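/- Let $B_n$ be the braid group on $n$ strands with standard generators $\sigma_1,\dots,\sigma_{n-1}$. Let $\beta\mapsto\bar\beta$ be the homomorphism $B_n\to S_n$ with $\bar\sigma_i=(i\ \,i{+}1)$, and let $B_n$ act on the right on $(\mathbb Z/r\mathbb Z)^n$, with standard basis $e_1,\dots,e_n$, by permuting coordinates: $(x\cdot\beta)_k=x_{\bar\beta(k)}$. Let $\phi_r:B_n\to(\mathbb Z/r\mathbb Z)^n$ be the crossed homomorphism with $\phi_r(\sigma_i)=e_{i+1}$ for $1\le i\le n-1$, that is, the unique map with these values that satisfies $\phi_r(\alpha\beta)=\phi_r(\alpha)\cdot\beta+\phi_r(\beta)$ for all $\alpha,\beta\in B_n$. Write $\ker(\phi_r)=\{\beta\in B_n:\phi_r(\beta)=0\}$, and let $\Gamma_n^r\le B_n$ be the subgroup generated by the basic twists $\sigma_a\sigma_{a+1}\cdots\sigma_{a+r-1}$, $1\le a\le n-r$. For $r\ge 2$ and $d\in\{0,1,2\}$ put $$n_0(r,d)=\begin{cases}8 & r=2,\\ (6+d)\,r & r\text{ odd},\\ (12+d)\,r & r\ge 4\text{ even}.\end{cases}$$ **Theorem.**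 Let $r\ge 2$, let $d\in\{0,1,2\}$ be the remainder of $n$ modulo $3$, and suppose $n\ge n_0(r,d)$. Then $\ker(\phi_r)=\Gamma_n^r$. If moreover $r$ divides $n-1$, then $\ker(\phi_r)$ is generated by the two elements $\sigma_1\sigma_2\cdots\sigma_r$ and $\sigma_1\sigma_2\cdots\sigma_{n-1}$. -/

import Mathlib

/-- The Artin relators on the `n - 1` generators `σ_0, …, σ_{n-2}` (all indices start at `0`):
`σ_i σ_{i+1} σ_i = σ_{i+1} σ_i σ_{i+1}`, and `σ_i σ_j = σ_j σ_i` whenever `|i - j| ≥ 2`. -/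
def braidRels (n : ℕ) : Set (FreeGroup (Fin (n - 1))) :=
  {x | ∃ i j : Fin (n - 1), i.val + 1 = j.val ∧
      x = (FreeGroup.of i * FreeGroup.of j * FreeGroup.of i) *
        (FreeGroup.of j * FreeGroup.of i * FreeGroup.of j)⁻¹} ∪
  {x | ∃ i j : Fin (n - 1), i.val + 1 < j.val ∧
      x = (FreeGroup.of i * FreeGroup.of j) * (FreeGroup.of j * FreeGroup.of i)⁻¹}

/-- The braid group `B_n` on `n` strands, in Artin's presentation. -/
abbrev BraidGroup (n : ℕ) : Type := PresentedGroup (braidRels n)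

/-- The standard generator `σ_i` of `B_n`, `0 ≤ i ≤ n - 2`. -/
def braidSigma {n : ℕ} (i : Fin (n - 1)) : BraidGroup n := PresentedGroup.of i

/-- The position `i` among the `n` positions `0, …, n - 1`. -/
def leftPos {n : ℕ} (i : Fin (n - 1)) : Fin n := ⟨i.val, by omega⟩

/-- The position `i + 1` among the `n` positions `0, …, n - 1`. -/
def rightPos {n : ℕ} (i : Fin (n - 1)) : Fin n := ⟨i.val + 1, by omega⟩

/-- A map on generators with values in a group that satisfies the Artin relations kills the
Artin relators. -/
theorem braidRels_lift_eq_one {n : ℕ} {G : Type*} [Group G] (f : Fin (n - 1) → G)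
    (h1 : ∀ i j : Fin (n - 1), i.val + 1 = j.val → f i * f j * f i = f j * f i * f j)
    (h2 : ∀ i j : Fin (n - 1), i.val + 1 < j.val → f i * f j = f j * f i) :
    ∀ x ∈ braidRels n, FreeGroup.lift f x = 1 := by
  rintro x (⟨i, j, hij, rfl⟩ | ⟨i, j, hij, rfl⟩)
  · simp only [map_mul, map_inv, FreeGroup.lift_apply_of, mul_inv_eq_one]
    exact h1 i j hij
  · simp only [map_mul, map_inv, FreeGroup.lift_apply_of, mul_inv_eq_one]
    exact h2 i j hij

theorem leftPos_ne_rightPos {n : ℕ} (i : Fin (n - 1)) : leftPos i ≠ rightPos i := by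
  simp [leftPos, rightPos, Fin.ext_iff]

theorem swap_braid {α : Type*} [DecidableEq α] {a b c : α} (hab : a ≠ b) (hac : a ≠ c)
    (hbc : b ≠ c) :
    Equiv.swap a b * Equiv.swap b c * Equiv.swap a b =
      Equiv.swap b c * Equiv.swap a b * Equiv.swap b c := by
  ext k
  simp only [Equiv.Perm.coe_mul, Function.comp_apply, Equiv.swap_apply_def]
  grind

theorem swap_comm_of_ne {α : Type*} [DecidableEq α] {a b c d : α} (hac : a ≠ c) (had : a ≠ d)
    (hbc : b ≠ c) (hbd : b ≠ d) :
    Equiv.swap a b * Equiv.swap c d = Equiv.swap c d * Equiv.swap a b := by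
  ext k
  simp only [Equiv.Perm.coe_mul, Function.comp_apply, Equiv.swap_apply_def]
  grind

/-- The permutation `B_n → S_n`, `σ_i ↦ (i i+1)`, underlying a braid. -/
def braidPerm (n : ℕ) : BraidGroup n →* Equiv.Perm (Fin n) :=
  PresentedGroup.toGroup (f := fun i => Equiv.swap (leftPos i) (rightPos i))
    (braidRels_lift_eq_one _
      (by
        intro i j hij
        have h : rightPos i = leftPos j := Fin.ext hij
        have h2 : leftPos i ≠ rightPos j := by
          simp only [leftPos, rightPos, ne_eq, Fin.ext_iff]; omega
        rw [h]
        exact swap_braid (h ▸ leftPos_ne_rightPos i) h2 (leftPos_ne_rightPos j))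
      (by
        intro i j hij
        apply swap_comm_of_ne <;> simp only [leftPos, rightPos, ne_eq, Fin.ext_iff] <;> omega))

/-- The affine bijection `x ↦ x · σ_i + e_{i+1}` of `(ℤ/rℤ)^n`, where `σ_i` acts by exchanging the
coordinates `i` and `i + 1`. -/
def affineGen (n r : ℕ) (i : Fin (n - 1)) : Equiv.Perm (Fin n → ZMod r) where
  toFun x := x ∘ Equiv.swap (leftPos i) (rightPos i) + Pi.single (rightPos i) 1
  invFun y := (y - Pi.single (rightPos i) 1) ∘ Equiv.swap (leftPos i) (rightPos i)
  left_inv x := by ext k; simp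
  right_inv y := by ext k; simp

/-- The action of `B_n` on `(ℤ/rℤ)^n` by affine bijections in which `σ_i` acts by `affineGen n r i`.
Words in the `σ_i` are read from left to right, the first letter acting first: this is a right
action, hence the opposite group. -/
def affineAction (n r : ℕ) : BraidGroup n →* (Equiv.Perm (Fin n → ZMod r))ᵐᵒᵖ :=
  PresentedGroup.toGroup (f := fun i => MulOpposite.op (affineGen n r i))
    (braidRels_lift_eq_one _
      (by
        intro i j hij
        have h : rightPos i = leftPos j := Fin.ext hij
        have hab : leftPos i ≠ leftPos j := h ▸ leftPos_ne_rightPos i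
        have hac : leftPos i ≠ rightPos j := by
          simp only [leftPos, rightPos, ne_eq, Fin.ext_iff]; omega
        have hbc := leftPos_ne_rightPos j
        apply MulOpposite.unop_injective
        ext x k
        simp only [MulOpposite.unop_mul, MulOpposite.unop_op, Equiv.Perm.coe_mul,
          Function.comp_apply, affineGen, Equiv.coe_fn_mk, Pi.add_apply, Pi.single_apply,
          Equiv.swap_apply_def, h]
        generalize leftPos i = a at *
        generalize leftPos j = b at *
        generalize rightPos j = c at *
        by_cases h1 : k = a
        · grind
        by_cases h2 : k = b
        · grind
        by_cases h3 : k = c <;> grind)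
      (by
        intro i j hij
        have hac : leftPos i ≠ leftPos j := by
          simp only [leftPos, ne_eq, Fin.ext_iff]; omega
        have had : leftPos i ≠ rightPos j := by
          simp only [leftPos, rightPos, ne_eq, Fin.ext_iff]; omega
        have hbc : rightPos i ≠ leftPos j := by
          simp only [leftPos, rightPos, ne_eq, Fin.ext_iff]; omega
        have hbd : rightPos i ≠ rightPos j := by
          simp only [rightPos, ne_eq, Fin.ext_iff]; omega
        have hab := leftPos_ne_rightPos i
        have hcd := leftPos_ne_rightPos j
        apply MulOpposite.unop_injective
        ext x k
        simp only [MulOpposite.unop_mul, MulOpposite.unop_op, Equiv.Perm.coe_mul,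
          Function.comp_apply, affineGen, Equiv.coe_fn_mk, Pi.add_apply, Pi.single_apply,
          Equiv.swap_apply_def]
        generalize leftPos i = a at *
        generalize rightPos i = b at *
        generalize leftPos j = c at *
        generalize rightPos j = d at *
        by_cases h1 : k = a
        · grind
        by_cases h2 : k = b
        · grind
        by_cases h3 : k = c
        · grind
        by_cases h4 : k = d <;> grind))

/-- The crossed homomorphism `φ_r : B_n → (ℤ/rℤ)^n`, as the translation part of the affine action.
It is the only map with `φ_r(σ_i) = e_{i+1}` and `φ_r(αβ) = φ_r(α) · β + φ_r(β)`; see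
`braidPhi_sigma`, `braidPhi_mul` and `eq_braidPhi`. -/
def braidPhi (n r : ℕ) (β : BraidGroup n) : Fin n → ZMod r :=
  (affineAction n r β).unop 0

theorem braidPerm_sigma {n : ℕ} (i : Fin (n - 1)) :
    braidPerm n (braidSigma i) = Equiv.swap (leftPos i) (rightPos i) :=
  PresentedGroup.toGroup.of _

theorem affineAction_sigma {n r : ℕ} (i : Fin (n - 1)) :
    affineAction n r (braidSigma i) = MulOpposite.op (affineGen n r i) :=
  PresentedGroup.toGroup.of _

theorem braidPhi_sigma {n r : ℕ} (i : Fin (n - 1)) :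
    braidPhi n r (braidSigma i) = Pi.single (rightPos i) 1 := by
  rw [braidPhi, affineAction_sigma]
  ext k
  simp [affineGen]

theorem affineAction_mul_apply {n r : ℕ} (α β : BraidGroup n) (x : Fin n → ZMod r) :
    (affineAction n r (α * β)).unop x =
      (affineAction n r β).unop ((affineAction n r α).unop x) := by
  rw [map_mul]; rfl

/-- The affine action is `x · β + φ_r(β)`, where `x · β = x ∘ braidPerm β` permutes coordinates. -/
theorem affineAction_apply {n r : ℕ} (β : BraidGroup n) :
    ∀ x : Fin n → ZMod r, (affineAction n r β).unop x = x ∘ braidPerm n β + braidPhi n r β := by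
  let H : Subgroup (BraidGroup n) :=
    { carrier := {γ | ∀ x y : Fin n → ZMod r,
        (affineAction n r γ).unop (x + y) = x ∘ braidPerm n γ + (affineAction n r γ).unop y}
      one_mem' := by
        intro x y
        simp only [map_one]
        rfl
      mul_mem' := by
        intro a b ha hb x y
        rw [affineAction_mul_apply, affineAction_mul_apply, ha, hb, map_mul]
        rfl
      inv_mem' := by
        intro a ha x y
        have key : ∀ z, (affineAction n r a).unop ((affineAction n r a⁻¹).unop z) = z := by
          intro z
          rw [← affineAction_mul_apply, inv_mul_cancel, map_one]
          rfl
        apply (affineAction n r a).unop.injective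
        rw [key, ha, key, map_inv]
        ext k
        simp }
  have hH : ∀ γ, γ ∈ H := by
    apply PresentedGroup.generated_by
    intro i x y
    change (affineAction n r (braidSigma i)).unop _ =
      x ∘ braidPerm n (braidSigma i) + (affineAction n r (braidSigma i)).unop y
    rw [affineAction_sigma, braidPerm_sigma]
    ext k
    simp [affineGen, add_assoc]
  intro x
  simpa [braidPhi] using hH β x 0

theorem braidPhi_mul {n r : ℕ} (α β : BraidGroup n) :
    braidPhi n r (α * β) = braidPhi n r α ∘ braidPerm n β + braidPhi n r β := by
  rw [← affineAction_apply, braidPhi, affineAction_mul_apply]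
  rfl

/-- The two properties above determine `φ_r`. -/
theorem eq_braidPhi {n r : ℕ} (f : BraidGroup n → Fin n → ZMod r)
    (h1 : ∀ i, f (braidSigma i) = Pi.single (rightPos i) 1)
    (h2 : ∀ α β, f (α * β) = f α ∘ braidPerm n β + f β) : f = braidPhi n r := by
  have one : ∀ g : BraidGroup n → Fin n → ZMod r,
      (∀ α β, g (α * β) = g α ∘ braidPerm n β + g β) → g 1 = 0 := by
    intro g hg
    have := hg 1 1
    simpa using this
  let H : Subgroup (BraidGroup n) :=
    { carrier := {γ | f γ = braidPhi n r γ}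
      one_mem' := by
        change f 1 = braidPhi n r 1
        rw [one f h2, one _ braidPhi_mul]
      mul_mem' := by
        intro a b ha hb
        change f (a * b) = braidPhi n r (a * b)
        rw [h2, braidPhi_mul, show f a = _ from ha, show f b = _ from hb]
      inv_mem' := by
        intro a ha
        change f a⁻¹ = braidPhi n r a⁻¹
        have e1 := h2 a a⁻¹
        have e2 := braidPhi_mul (r := r) a a⁻¹
        rw [mul_inv_cancel] at e1 e2
        rw [one f h2, show f a = _ from ha] at e1
        rw [one _ braidPhi_mul] at e2
        exact add_left_cancel (e1.symm.trans e2) }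
  funext γ
  exact PresentedGroup.generated_by _ H
    (fun i => (h1 i).trans (braidPhi_sigma i).symm) γ

/-- The kernel `{β | φ_r(β) = 0}` of the crossed homomorphism `φ_r`, a subgroup of `B_n`. -/
def braidPhiKer (n r : ℕ) : Subgroup (BraidGroup n) where
  carrier := {β | braidPhi n r β = 0}
  one_mem' := by
    change braidPhi n r 1 = 0
    simp only [braidPhi, map_one]
    rfl
  mul_mem' := by
    intro a b ha hb
    change braidPhi n r (a * b) = 0
    rw [braidPhi_mul, show braidPhi n r a = 0 from ha, show braidPhi n r b = 0 from hb]
    ext k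
    simp
  inv_mem' := by
    intro a ha
    change (affineAction n r a⁻¹).unop 0 = 0
    rw [map_inv, MulOpposite.unop_inv, Equiv.Perm.inv_eq_iff_eq]
    exact (show (affineAction n r a).unop 0 = 0 from ha).symm

/-- The basic twist `σ_a σ_{a+1} ⋯ σ_{a+r-1}` in `B_n`, for `0 ≤ a` and `a + r < n`. -/
def basicTwist {n : ℕ} (a r : ℕ) (h : a + r < n) : BraidGroup n :=
  (List.ofFn fun k : Fin r => braidSigma (n := n) ⟨a + k.val, by omega⟩).prod

/-- The subgroup `Γ_n^r` of `B_n` generated by all basic twists `σ_a ⋯ σ_{a+r-1}`. -/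
def basicTwistGroup (n r : ℕ) : Subgroup (BraidGroup n) :=
  Subgroup.closure {g | ∃ (a : ℕ) (h : a + r < n), g = basicTwist a r h}

/-- The bound `n_0(r, d)`. -/
def boundN0 (r d : ℕ) : ℕ :=
  if r = 2 then 8 else if Odd r then (6 + d) * r else (12 + d) * r

theorem zero_add_lt_of_boundN0_le {n r d : ℕ} (hr : 2 ≤ r) (hn : boundN0 r d ≤ n) : 0 + r < n := by
  unfold boundN0 at hn
  split_ifs at hn
  · omega
  · nlinarith
  · nlinarith

theorem zero_add_sub_one_lt_of_boundN0_le {n r d : ℕ} (hr : 2 ≤ r) (hn : boundN0 r d ≤ n) :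
    0 + (n - 1) < n := by
  have := zero_add_lt_of_boundN0_le hr hn
  omega

/-!
Write `Γ` for `basicTwistGroup n r`. Think of `(ℤ/rℤ)^n` as labellings of the `n` positions, on
which `B_n` acts from the right by affine bijections (`braidAct`): `σ_i` exchanges the labels at `i`
and `i + 1` and adds `1` to the one that moves to the right. The kernel of `φ_r` is the stabilizer
of the zero labelling, and it contains `Γ`. So the task is to show that a right coset of `Γ` is
determined by the labelling it sends `0` to. The argument works for all `n ≥ 4r`.

The run `σ_a ⋯ σ_{a+l-1}` carries a strand `l` places to the right, its inverse fetches a strand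
from `l` places to the right and gives it the label `-l`. Runs of length `r` lie in `Γ`, hence
modulo `Γ` the first such move depends on its length modulo `r` only (`twistEquiv_inv_braidRun`).
If two strands are fetched one after the other to the positions `0` and `1` and then cross, the
result is the same as fetching them in the opposite order, provided the lengths of the two moves
compare in the right way (`inv_braidRun_mul_braidGen`). Modulo `Γ` the lengths may be increased by
`r`, and the rule holds without that proviso (`twistEquiv_inv_braidRun_mul_braidGen`). It persists
behind strands that have been fetched to the positions before, since these can be fetched from
beyond all the strands involved, that is, after the move in question (`TwistEquiv.shift`).
Consequently the cosets of the elements `fetchBraid n [l_0, …, l_{m-1}]` with `l_i < r`, which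
fetch strands to the positions `0, …, m - 1` successively, are permuted by the crossings of the
first `m` strands (`exists_fetchBraid_mul_braidGen`). As `fetchBraid n [l_0, …, l_{m-1}]` sends `0`
to a labelling with entries `-l_i`, a braid on the first `m` strands that fixes `0` lies in `Γ`, if
`m ≤ n - 2r + 1` (`mem_basicTwistGroup_of_mem_left`). The automorphism `σ_i ↦ σ_{n-2-i}⁻¹` gives
the same for the strands at the right end (`mem_basicTwistGroup_of_mem_right`).

Finally every coset contains a product of a braid `b` on the first `2r` strands and a braid `b'` on
the last `n - 2r` strands (`exists_twistEquiv_mul`). The point is that these cosets are stable under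
the crossing of the two middle strands. Since the braids on at least three strands act transitively
on the labellings of these strands (`sameOrbit_of_eq`), the results for the two ends allow one to
write the coset of `b * b'` such that the two middle labels are brought to their places first, from
the left and from the right respectively, and then the crossing is computed by the rules above
(`twistEquiv_middle`). If `b * b'` fixes `0`, so do `b` and `b'`, because they act on disjoint sets
of positions, and both lie in `Γ`.

For the second statement, conjugation by `δ = σ_0 ⋯ σ_{n-2}` carries each basic twist to the next
one, and `δ` is a product of basic twists if `r` divides `n - 1`.
-/

/-! ### Generators, runs and intervals -/

/-- The generator `σ_i` of `B_n` for an arbitrary natural number `i`; it is `1` when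
`i ≥ n - 1`. -/
def braidGen (n i : ℕ) : BraidGroup n :=
  if h : i < n - 1 then braidSigma ⟨i, h⟩ else 1

theorem braidGen_of_lt {n i : ℕ} (h : i < n - 1) : braidGen n i = braidSigma ⟨i, h⟩ :=
  dif_pos h

theorem braidGen_of_le {n i : ℕ} (h : n - 1 ≤ i) : braidGen n i = 1 :=
  dif_neg (by omega)

theorem braidGen_braid {n i : ℕ} (h : i + 1 < n - 1) :
    braidGen n i * braidGen n (i + 1) * braidGen n i =
      braidGen n (i + 1) * braidGen n i * braidGen n (i + 1) := by
  rw [braidGen_of_lt h, braidGen_of_lt (show i < n - 1 by omega)]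
  exact PresentedGroup.mk_eq_mk_of_mul_inv_mem (rels := braidRels n)
    (Or.inl ⟨⟨i, by omega⟩, ⟨i + 1, h⟩, rfl, rfl⟩)

theorem commute_braidGen_of_lt {n i j : ℕ} (hij : i + 1 < j) :
    Commute (braidGen n i) (braidGen n j) := by
  by_cases hj : j < n - 1
  · rw [braidGen_of_lt hj, braidGen_of_lt (show i < n - 1 by omega)]
    exact PresentedGroup.mk_eq_mk_of_mul_inv_mem (rels := braidRels n)
      (Or.inr ⟨⟨i, by omega⟩, ⟨j, hj⟩, hij, rfl⟩)
  · rw [braidGen_of_le (show n - 1 ≤ j by omega)]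
    exact Commute.one_right _

theorem commute_braidGen {n i j : ℕ} (h : i + 1 < j ∨ j + 1 < i) :
    Commute (braidGen n i) (braidGen n j) :=
  h.elim commute_braidGen_of_lt fun h => (commute_braidGen_of_lt h).symm

/-- The run `σ_a σ_{a+1} ⋯ σ_{a+l-1}`, which carries the strand at position `a` to position
`a + l`. -/
def braidRun (n a : ℕ) : ℕ → BraidGroup n
  | 0 => 1
  | l + 1 => braidRun n a l * braidGen n (a + l)

@[simp]
theorem braidRun_zero (n a : ℕ) : braidRun n a 0 = 1 := rfl

theorem braidRun_succ (n a l : ℕ) :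
    braidRun n a (l + 1) = braidRun n a l * braidGen n (a + l) := rfl

theorem braidRun_add (n a k l : ℕ) :
    braidRun n a (k + l) = braidRun n a k * braidRun n (a + k) l := by
  induction l with
  | zero => simp
  | succ l ih => rw [← add_assoc, braidRun_succ, ih, braidRun_succ, mul_assoc, add_assoc]

theorem braidRun_succ' (n a l : ℕ) :
    braidRun n a (l + 1) = braidGen n a * braidRun n (a + 1) l := by
  rw [add_comm l 1, braidRun_add]
  simp [braidRun_succ]

theorem basicTwist_eq_braidRun {n a r : ℕ} (h : a + r < n) :
    basicTwist a r h = braidRun n a r := by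
  induction r with
  | zero => simp [basicTwist]
  | succ r ih =>
    rw [braidRun_succ, ← ih (by omega), braidGen_of_lt (show a + r < n - 1 by omega)]
    simp only [basicTwist, List.ofFn_succ', List.concat_eq_append, List.prod_append,
      List.prod_singleton]
    rfl

/-- The subgroup generated by the `σ_i` with `a ≤ i < b`: the braids that move only the strands at
the positions `a, …, b`. -/
def braidInterval (n a b : ℕ) : Subgroup (BraidGroup n) :=
  Subgroup.closure (braidGen n '' Set.Ico a b)

theorem braidGen_mem_braidInterval {n a b i : ℕ} (ha : a ≤ i) (hb : i < b) :
    braidGen n i ∈ braidInterval n a b :=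
  Subgroup.subset_closure ⟨i, ⟨ha, hb⟩, rfl⟩

theorem braidInterval_le_iff {n a b : ℕ} {K : Subgroup (BraidGroup n)} :
    braidInterval n a b ≤ K ↔ ∀ i, a ≤ i → i < b → braidGen n i ∈ K := by
  rw [braidInterval, Subgroup.closure_le]
  constructor
  · exact fun h i h1 h2 => h ⟨i, ⟨h1, h2⟩, rfl⟩
  · rintro h _ ⟨i, ⟨h1, h2⟩, rfl⟩
    exact h i h1 h2

theorem braidInterval_mono {n a b a' b' : ℕ} (ha : a' ≤ a) (hb : b ≤ b') :
    braidInterval n a b ≤ braidInterval n a' b' :=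
  braidInterval_le_iff.2 fun _ h1 h2 =>
    braidGen_mem_braidInterval (ha.trans h1) (h2.trans_le hb)

theorem braidRun_mem_braidInterval {n a b a' l : ℕ} (ha : a ≤ a') (hb : a' + l ≤ b) :
    braidRun n a' l ∈ braidInterval n a b := by
  induction l with
  | zero => exact one_mem _
  | succ l ih =>
    exact mul_mem (ih (by omega)) (braidGen_mem_braidInterval (by omega) (by omega))

theorem commute_of_mem_braidInterval {n a b c d : ℕ} (h : b < c) {x y : BraidGroup n}
    (hx : x ∈ braidInterval n a b) (hy : y ∈ braidInterval n c d) : Commute x y := by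
  have hle : braidInterval n a b ≤ Subgroup.centralizer (braidInterval n c d : Set _) := by
    rw [braidInterval_le_iff]
    intro i _ hi
    rw [Subgroup.mem_centralizer_iff]
    intro z hz
    have : braidInterval n c d ≤ Subgroup.centralizer {braidGen n i} := by
      rw [braidInterval_le_iff]
      intro j hj _
      rw [Subgroup.mem_centralizer_iff]
      rintro _ rfl
      exact commute_braidGen_of_lt (by omega)
    exact ((Subgroup.mem_centralizer_iff.1 (this hz)) _ rfl).symm
  exact ((Subgroup.mem_centralizer_iff.1 (hle hx)) y hy).symm

theorem mem_braidInterval_full {n : ℕ} (β : BraidGroup n) : β ∈ braidInterval n 0 (n - 1) := by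
  refine PresentedGroup.generated_by _ _ (fun i => ?_) β
  have := braidGen_mem_braidInterval (n := n) (Nat.zero_le i.val) i.isLt
  rwa [braidGen_of_lt i.isLt] at this

/-- Conjugation by a run shifts the generators inside it by one. -/
theorem braidRun_mul_braidGen {n a l i : ℕ} (ha : a ≤ i) (hi : i + 1 < a + l) (hl : a + l ≤ n - 1) :
    braidRun n a l * braidGen n i = braidGen n (i + 1) * braidRun n a l := by
  induction l with
  | zero => omega
  | succ l ih =>
    rw [braidRun_succ]
    rcases Nat.lt_or_ge (i + 1) (a + l) with h | h
    · rw [mul_assoc, (commute_braidGen_of_lt h).eq.symm, ← mul_assoc, ih h (by omega), mul_assoc]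
    · obtain ⟨l, rfl⟩ : ∃ k, l = k + 1 := ⟨l - 1, by omega⟩
      obtain rfl : i = a + l := by omega
      have hc : Commute (braidRun n a l) (braidGen n (a + l + 1)) :=
        commute_of_mem_braidInterval (Nat.lt_succ_self (a + l))
          (braidRun_mem_braidInterval le_rfl le_rfl)
          (braidGen_mem_braidInterval le_rfl (Nat.lt_succ_self _))
      rw [braidRun_succ, ← add_assoc]
      calc braidRun n a l * braidGen n (a + l) * braidGen n (a + l + 1) * braidGen n (a + l)
          = braidRun n a l *
              (braidGen n (a + l) * braidGen n (a + l + 1) * braidGen n (a + l)) := by group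
        _ = braidRun n a l * braidGen n (a + l + 1) *
              (braidGen n (a + l) * braidGen n (a + l + 1)) := by
            rw [braidGen_braid (by omega)]; group
        _ = _ := by rw [hc.eq]; group

theorem braidRun_mul_braidRun {n a k l : ℕ} (hk : k < l) (hl : a + l ≤ n - 1) :
    braidRun n a l * braidRun n a k = braidRun n (a + 1) k * braidRun n a l := by
  induction k with
  | zero => simp
  | succ k ih =>
    rw [braidRun_succ, ← mul_assoc, ih (by omega), mul_assoc,
      braidRun_mul_braidGen (by omega) (by omega) hl, braidRun_succ, mul_assoc, add_right_comm]

/-- The full run `δ = σ_0 ⋯ σ_{n-2}`. -/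
def braidDelta (n : ℕ) : BraidGroup n := braidRun n 0 (n - 1)

/-- The shift `β ↦ δ β δ⁻¹`, which sends `σ_i` to `σ_{i+1}` for `i + 1 < n - 1`. -/
def braidShift (n : ℕ) : BraidGroup n →* BraidGroup n := (MulAut.conj (braidDelta n)).toMonoidHom

theorem braidShift_apply {n : ℕ} (x : BraidGroup n) :
    braidShift n x = braidDelta n * x * (braidDelta n)⁻¹ := rfl

theorem braidShift_braidGen {n i : ℕ} (h : i + 1 < n - 1) :
    braidShift n (braidGen n i) = braidGen n (i + 1) := by
  rw [braidShift_apply, braidDelta, braidRun_mul_braidGen (Nat.zero_le i) (by omega) (by omega),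
    mul_inv_cancel_right]

theorem braidShift_braidRun {n a l : ℕ} (h : a + l < n - 1) :
    braidShift n (braidRun n a l) = braidRun n (a + 1) l := by
  induction l with
  | zero => simp
  | succ l ih =>
    rw [braidRun_succ, map_mul, ih (by omega), braidShift_braidGen (by omega), braidRun_succ,
      add_right_comm]

theorem braidShift_mem {n a b : ℕ} (h : b + 1 < n) {x : BraidGroup n}
    (hx : x ∈ braidInterval n a b) : braidShift n x ∈ braidInterval n (a + 1) (b + 1) := by
  have hle : braidInterval n a b ≤ (braidInterval n (a + 1) (b + 1)).comap (braidShift n) := by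
    rw [braidInterval_le_iff]
    intro i ha hb
    rw [Subgroup.mem_comap, braidShift_braidGen (by omega)]
    exact braidGen_mem_braidInterval (by omega) (by omega)
  exact hle hx

/-- A run from the left end that is long enough induces the same shift as the full run. -/
theorem braidRun_mul_of_mem {n R l : ℕ} (hR : R < l) (hl : l ≤ n - 1) {x : BraidGroup n}
    (hx : x ∈ braidInterval n 0 R) : braidRun n 0 l * x = braidShift n x * braidRun n 0 l := by
  have h := braidRun_add n 0 l (n - 1 - l)
  rw [show l + (n - 1 - l) = n - 1 by omega, zero_add] at h
  have hc : Commute x (braidRun n l (n - 1 - l)) :=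
    commute_of_mem_braidInterval hR hx (braidRun_mem_braidInterval le_rfl le_rfl)
  rw [braidShift_apply, braidDelta, h]
  calc braidRun n 0 l * x
      = braidRun n 0 l * (x * braidRun n l (n - 1 - l)) * (braidRun n l (n - 1 - l))⁻¹ := by group
    _ = _ := by rw [hc.eq]; group

/-! ### The action on states -/

/-- The affine action of a braid on the state `x`. -/
def braidAct {n r : ℕ} (β : BraidGroup n) (x : Fin n → ZMod r) : Fin n → ZMod r :=
  (affineAction n r β).unop x

theorem mem_braidPhiKer {n r : ℕ} {β : BraidGroup n} :
    β ∈ braidPhiKer n r ↔ braidAct (r := r) β 0 = 0 := Iff.rfl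

@[simp]
theorem braidAct_one {n r : ℕ} (x : Fin n → ZMod r) : braidAct 1 x = x := by
  simp only [braidAct, map_one]; rfl

theorem braidAct_mul {n r : ℕ} (α β : BraidGroup n) (x : Fin n → ZMod r) :
    braidAct (α * β) x = braidAct β (braidAct α x) :=
  affineAction_mul_apply α β x

@[simp]
theorem braidAct_inv_braidAct {n r : ℕ} (β : BraidGroup n) (x : Fin n → ZMod r) :
    braidAct β⁻¹ (braidAct β x) = x := by
  rw [← braidAct_mul, mul_inv_cancel, braidAct_one]

@[simp]
theorem braidAct_braidAct_inv {n r : ℕ} (β : BraidGroup n) (x : Fin n → ZMod r) :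
    braidAct β (braidAct β⁻¹ x) = x := by
  rw [← braidAct_mul, inv_mul_cancel, braidAct_one]

theorem mul_inv_mem_braidPhiKer {n r : ℕ} {α β : BraidGroup n} :
    α * β⁻¹ ∈ braidPhiKer n r ↔ braidAct (r := r) α 0 = braidAct β 0 := by
  rw [mem_braidPhiKer, braidAct_mul]
  constructor
  · intro h
    rw [← braidAct_braidAct_inv β (braidAct α 0), h]
  · intro h
    rw [h, braidAct_inv_braidAct]

theorem braidAct_braidGen {n r i : ℕ} (h : i + 1 < n) (x : Fin n → ZMod r) :
    braidAct (braidGen n i) x =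
      x ∘ Equiv.swap ⟨i, by omega⟩ ⟨i + 1, h⟩ + Pi.single ⟨i + 1, h⟩ 1 := by
  rw [braidAct, braidGen_of_lt (show i < n - 1 by omega), affineAction_sigma]
  rfl

theorem braidAct_braidGen_left {n r i : ℕ} (h : i + 1 < n) (x : Fin n → ZMod r) :
    braidAct (braidGen n i) x ⟨i, by omega⟩ = x ⟨i + 1, h⟩ := by
  rw [braidAct_braidGen h]
  simp

theorem braidAct_braidGen_right {n r i : ℕ} (h : i + 1 < n) (x : Fin n → ZMod r) :
    braidAct (braidGen n i) x ⟨i + 1, h⟩ = x ⟨i, by omega⟩ + 1 := by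
  rw [braidAct_braidGen h]
  simp

theorem braidAct_braidGen_of_ne {n r i : ℕ} {q : Fin n} (h1 : q.val ≠ i) (h2 : q.val ≠ i + 1)
    (x : Fin n → ZMod r) : braidAct (braidGen n i) x q = x q := by
  by_cases h : i + 1 < n
  · rw [braidAct_braidGen h]
    have e1 : q ≠ ⟨i, by omega⟩ := fun e => h1 (congrArg Fin.val e)
    have e2 : q ≠ ⟨i + 1, h⟩ := fun e => h2 (congrArg Fin.val e)
    simp [Equiv.swap_apply_of_ne_of_ne e1 e2, e2]
  · rw [braidGen_of_le (by omega), braidAct_one]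

/-- The braids in `braidInterval n a b` do not affect the coordinates outside `[a, b]`. -/
theorem braidAct_of_mem_braidInterval {n r a b : ℕ} {β : BraidGroup n}
    (hβ : β ∈ braidInterval n a b) {q : Fin n} (hq : q.val < a ∨ b < q.val)
    (x : Fin n → ZMod r) : braidAct β x q = x q := by
  let K : Subgroup (BraidGroup n) :=
    { carrier := {γ | ∀ x : Fin n → ZMod r, braidAct γ x q = x q}
      one_mem' := fun x => by rw [braidAct_one]
      mul_mem' := fun {α γ} hα hγ x => by rw [braidAct_mul, hγ, hα]
      inv_mem' := fun {α} hα x => by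
        have := hα (braidAct α⁻¹ x)
        rw [braidAct_braidAct_inv] at this
        exact this.symm }
  have hle : braidInterval n a b ≤ K := braidInterval_le_iff.2 fun i h1 h2 x =>
    braidAct_braidGen_of_ne (by omega) (by omega) x
  exact hle hβ x

/-- A run of length `l` carries the label at its left end `l` places to the right and increases
it by `l`. -/
theorem braidAct_braidRun_apply {n r a l : ℕ} (h : a + l < n) (x : Fin n → ZMod r) :
    braidAct (braidRun n a l) x ⟨a + l, h⟩ = x ⟨a, by omega⟩ + l := by
  induction l with
  | zero => simp
  | succ l ih =>
    rw [braidRun_succ, braidAct_mul]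
    have := braidAct_braidGen_right (r := r) (i := a + l) h (braidAct (braidRun n a l) x)
    rw [ih (by omega)] at this
    exact this.trans (by push_cast; ring)

theorem braidAct_braidGen_add_single {n r i : ℕ} (h : i + 1 < n) {x : Fin n → ZMod r}
    (h0 : x ⟨i, by omega⟩ = 0) (h1 : x ⟨i + 1, h⟩ = 0) (a : ZMod r) :
    braidAct (braidGen n i) (x + Pi.single ⟨i, by omega⟩ a) =
      x + Pi.single ⟨i + 1, h⟩ (a + 1) := by
  rw [braidAct_braidGen h]
  ext q
  by_cases e1 : q = ⟨i + 1, h⟩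
  · subst e1; simp [h0, h1]
  · by_cases e2 : q = ⟨i, by omega⟩
    · subst e2; simp [h0, h1]
    · simp [Equiv.swap_apply_of_ne_of_ne e2 e1, e1, e2]

theorem braidAct_braidRun_zero {n r a l : ℕ} (h : a + l < n) :
    braidAct (braidRun n a l) (0 : Fin n → ZMod r) = Pi.single ⟨a + l, h⟩ (l : ZMod r) := by
  induction l with
  | zero => simp
  | succ l ih =>
    have := braidAct_braidGen_add_single (r := r) (x := 0) (i := a + l) h rfl rfl l
    rw [zero_add, zero_add] at this
    rw [braidRun_succ, braidAct_mul, ih (by omega), Nat.cast_succ]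
    exact this

theorem basicTwistGroup_le_braidPhiKer (n r : ℕ) : basicTwistGroup n r ≤ braidPhiKer n r := by
  rw [basicTwistGroup, Subgroup.closure_le]
  rintro _ ⟨a, h, rfl⟩
  rw [SetLike.mem_coe, mem_braidPhiKer, basicTwist_eq_braidRun, braidAct_braidRun_zero h]
  simp

/-! ### Transitivity of the action of an interval -/

/-- The states `x` and `y` differ by the action of the braids on the first `p` strands. -/
def SameOrbit (n r p : ℕ) (x y : Fin n → ZMod r) : Prop :=
  ∃ β ∈ braidInterval n 0 (p - 1), braidAct β x = y

namespace SameOrbit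

variable {n r p : ℕ} {x y z : Fin n → ZMod r}

theorem refl (x : Fin n → ZMod r) : SameOrbit n r p x x := ⟨1, one_mem _, braidAct_one x⟩

theorem symm (h : SameOrbit n r p x y) : SameOrbit n r p y x := by
  obtain ⟨β, hβ, rfl⟩ := h
  exact ⟨β⁻¹, inv_mem hβ, braidAct_inv_braidAct β x⟩

theorem trans (h : SameOrbit n r p x y) (h' : SameOrbit n r p y z) : SameOrbit n r p x z := by
  obtain ⟨β, hβ, rfl⟩ := h
  obtain ⟨γ, hγ, rfl⟩ := h'
  exact ⟨β * γ, mul_mem hβ hγ, braidAct_mul β γ x⟩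

theorem braidGen {i : ℕ} (hi : i + 1 < p) (x : Fin n → ZMod r) :
    SameOrbit n r p x (braidAct (braidGen n i) x) :=
  ⟨_, braidGen_mem_braidInterval (Nat.zero_le i) (by omega), rfl⟩

/-- `σ_i²` translates by `e_i + e_{i+1}`. -/
theorem translate {i : ℕ} (hi : i + 1 < p) (hn : i + 1 < n) (c : ZMod r) [NeZero r]
    (x : Fin n → ZMod r) :
    SameOrbit n r p x (x + Pi.single ⟨i, by omega⟩ c + Pi.single ⟨i + 1, hn⟩ c) := by
  obtain ⟨k, rfl⟩ : ∃ k : ℕ, (k : ZMod r) = c := ⟨c.val, ZMod.natCast_zmod_val c⟩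
  induction k with
  | zero => simpa using refl x
  | succ k ih =>
    refine (ih.trans (braidGen hi _)).trans ?_
    convert braidGen hi _ using 1
    rw [braidAct_braidGen hn, braidAct_braidGen hn]
    ext q
    have e : (⟨i, by omega⟩ : Fin n) ≠ ⟨i + 1, hn⟩ := by simp
    by_cases h1 : q = ⟨i + 1, hn⟩
    · subst h1; simp [add_assoc]
    · by_cases h2 : q = ⟨i, by omega⟩
      · subst h2; simp [add_assoc]
      · simp [Equiv.swap_apply_of_ne_of_ne h2 h1, h1, h2]

end SameOrbit

/-- The translations by `e_i + e_{i+1}` clear all coordinates below `p` but the first one. -/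
theorem exists_sameOrbit_single {n r p : ℕ} [NeZero r] (hp0 : 0 < p) (hp : p ≤ n)
    (x : Fin n → ZMod r) : ∃ a : ZMod r, SameOrbit n r p x
      (fun q => if q.val < p then if q.val = 0 then a else 0 else x q) := by
  -- clear the coordinates from the right; after `k` steps the last `k` of them vanish
  have key : ∀ k < p, ∃ y : Fin n → ZMod r, SameOrbit n r p x y ∧
      (∀ q : Fin n, p ≤ q.val → y q = x q) ∧
      ∀ q : Fin n, p - k ≤ q.val → q.val < p → y q = 0 := by
    intro k
    induction k with
    | zero => exact fun _ => ⟨x, .refl x, fun _ _ => rfl, fun q h1 h2 => by omega⟩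
    | succ k ih =>
      intro hk
      obtain ⟨y, hy, h1, h2⟩ := ih (by omega)
      obtain ⟨i, hi⟩ : ∃ i, p = i + 2 + k := ⟨p - 2 - k, by omega⟩
      refine ⟨_, hy.trans (.translate (i := i) (by omega) (by omega)
        (-y ⟨i + 1, by omega⟩) y), fun q hq => ?_, fun q h3 h4 => ?_⟩
      · simp only [Pi.add_apply, Pi.single_apply, Fin.ext_iff]
        rw [if_neg (by omega), if_neg (by omega), add_zero, add_zero, h1 q hq]
      · simp only [Pi.add_apply, Pi.single_apply, Fin.ext_iff]
        rw [if_neg (show q.val ≠ i by omega), add_zero]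
        split_ifs with h5
        · rw [show q = ⟨i + 1, by omega⟩ from Fin.ext h5]
          simp
        · rw [add_zero, h2 q (by omega) h4]
  obtain ⟨y, hy, h1, h2⟩ := key (p - 1) (by omega)
  refine ⟨y ⟨0, by omega⟩, ?_⟩
  convert hy using 1
  ext q
  split_ifs with h3 h4
  · rw [show q = ⟨0, by omega⟩ from Fin.ext h4]
  · exact (h2 q (by omega) h3).symm
  · exact (h1 q (by omega)).symm

/-- A state that vanishes on the first three strands may be changed arbitrarily at the first one. -/
theorem sameOrbit_add_single {n r p : ℕ} [NeZero r] (hp : 3 ≤ p) (hn : p ≤ n) {x : Fin n → ZMod r}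
    (h0 : x ⟨0, by omega⟩ = 0) (h1 : x ⟨1, by omega⟩ = 0) (h2 : x ⟨2, by omega⟩ = 0)
    (a : ZMod r) : SameOrbit n r p (x + Pi.single ⟨0, by omega⟩ a) x := by
  -- the label moves one place to the right and is then cancelled against its neighbour
  have neg : ∀ a : ZMod r, SameOrbit n r p (x + Pi.single ⟨0, by omega⟩ a)
      (x + Pi.single ⟨0, by omega⟩ (-(a + 1))) := by
    intro a
    have e := SameOrbit.braidGen (r := r) (n := n) (p := p) (i := 0) (by omega)
      (x + Pi.single ⟨0, by omega⟩ a)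
    rw [braidAct_braidGen_add_single (by omega) h0 h1] at e
    convert e.trans (.translate (i := 0) (by omega) (by omega) (-(a + 1)) _) using 1
    simp only [zero_add, Pi.single_neg]
    abel
  -- the label moves two places to the right and is then cancelled in two steps
  have two : ∀ a : ZMod r, SameOrbit n r p (x + Pi.single ⟨0, by omega⟩ a)
      (x + Pi.single ⟨0, by omega⟩ (a + 2)) := by
    intro a
    have e := SameOrbit.braidGen (r := r) (n := n) (p := p) (i := 0) (by omega)
      (x + Pi.single ⟨0, by omega⟩ a)
    rw [braidAct_braidGen_add_single (by omega) h0 h1] at e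
    have e' := SameOrbit.braidGen (r := r) (n := n) (p := p) (i := 1) (by omega)
      (x + Pi.single ⟨1, by omega⟩ (a + 1))
    rw [braidAct_braidGen_add_single (by omega) h1 h2] at e'
    convert (e.trans e').trans ((SameOrbit.translate (i := 1) (by omega) (by omega)
      (-(a + 2)) _).trans (.translate (i := 0) (by omega) (by omega) (a + 2) _)) using 1
    rw [show a + 1 + 1 = a + 2 by ring]
    simp only [Nat.reduceAdd, Pi.single_neg]
    abel
  have nat : ∀ k : ℕ, SameOrbit n r p (x + Pi.single ⟨0, by omega⟩ (k : ZMod r)) x := by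
    intro k
    induction k using Nat.twoStepInduction with
    | zero => simpa using SameOrbit.refl x
    | one =>
      convert (neg _).trans (two _) using 1
      norm_num
    | more k ih _ =>
      push_cast
      exact (two _).symm.trans ih
  rw [← ZMod.natCast_zmod_val a]
  exact nat _

/-- The braids on the first `p ≥ 3` strands act transitively on the states with prescribed
coordinates outside these strands. -/
theorem sameOrbit_of_eq {n r p : ℕ} [NeZero r] (hp : 3 ≤ p) (hn : p ≤ n) {x y : Fin n → ZMod r}
    (h : ∀ q : Fin n, p ≤ q.val → x q = y q) : SameOrbit n r p x y := by
  have key : ∀ x : Fin n → ZMod r,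
      SameOrbit n r p x (fun q => if q.val < p then 0 else x q) := by
    intro x
    obtain ⟨a, ha⟩ := exists_sameOrbit_single (by omega) hn x
    refine ha.trans ?_
    convert sameOrbit_add_single (x := fun q => if q.val < p then 0 else x q) hp hn ?_ ?_ ?_ a
      using 1
    · ext q
      by_cases h0 : q = ⟨0, by omega⟩
      · subst h0
        simp [show 0 < p by omega]
      · have : q.val ≠ 0 := fun e => h0 (Fin.ext e)
        simp [h0, this]
    all_goals exact if_pos (by simp only; omega)
  refine (key x).trans ?_
  convert (key y).symm using 1
  ext q
  split_ifs with hq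
  · rfl
  · exact h q (by omega)

/-! ### Cosets of the twist group -/

/-- The braids `x` and `y` lie in the same right coset of `Γ_n^r`. -/
def TwistEquiv {n : ℕ} (r : ℕ) (x y : BraidGroup n) : Prop := x * y⁻¹ ∈ basicTwistGroup n r

namespace TwistEquiv

variable {n r : ℕ} {x y z : BraidGroup n}

theorem of_eq (h : x = y) : TwistEquiv r x y := by
  rw [TwistEquiv, h, mul_inv_cancel]
  exact one_mem _

theorem refl (x : BraidGroup n) : TwistEquiv r x x := of_eq rfl

theorem symm (h : TwistEquiv r x y) : TwistEquiv r y x := by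
  have := inv_mem h
  rwa [mul_inv_rev, inv_inv] at this

theorem trans (h : TwistEquiv r x y) (h' : TwistEquiv r y z) : TwistEquiv r x z := by
  have := mul_mem h h'
  rwa [mul_assoc, inv_mul_cancel_left] at this

instance : Trans (TwistEquiv (n := n) r) (TwistEquiv r) (TwistEquiv r) := ⟨trans⟩

theorem mul_right (h : TwistEquiv r x y) (z : BraidGroup n) : TwistEquiv r (x * z) (y * z) := by
  rw [TwistEquiv] at h ⊢
  rwa [mul_inv_rev, mul_assoc, mul_inv_cancel_left]

theorem mem_braidPhiKer_iff (h : TwistEquiv r x y) :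
    x ∈ braidPhiKer n r ↔ y ∈ braidPhiKer n r := by
  have := (braidPhiKer n r).mul_mem_cancel_left (basicTwistGroup_le_braidPhiKer n r h) (y := y)
  rwa [inv_mul_cancel_right] at this

end TwistEquiv

theorem braidRun_mem_basicTwistGroup {n r a : ℕ} (h : a + r < n) :
    braidRun n a r ∈ basicTwistGroup n r :=
  Subgroup.subset_closure ⟨a, h, (basicTwist_eq_braidRun h).symm⟩

theorem braidRun_mul_mem_basicTwistGroup {n r a t : ℕ} (h : a + r * t < n) :
    braidRun n a (r * t) ∈ basicTwistGroup n r := by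
  induction t with
  | zero => exact one_mem _
  | succ t ih =>
    rw [Nat.mul_succ] at h ⊢
    rw [braidRun_add]
    exact mul_mem (ih (by omega)) (braidRun_mem_basicTwistGroup (by omega))

/-- Modulo `Γ_n^r`, the inverse of a run depends on its length modulo `r` only. -/
theorem twistEquiv_inv_braidRun {n r a l l' : ℕ} (h : l ≡ l' [MOD r]) (hl : a + l < n)
    (hl' : a + l' < n) : TwistEquiv r (braidRun n a l)⁻¹ (braidRun n a l')⁻¹ := by
  wlog hle : l ≤ l' generalizing l l'
  · exact (this h.symm hl' hl (by omega)).symm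
  obtain ⟨t, ht⟩ := (Nat.modEq_iff_dvd' hle).1 h
  obtain rfl : l' = l + r * t := by omega
  rw [TwistEquiv, inv_inv, braidRun_add, inv_mul_cancel_left]
  exact braidRun_mul_mem_basicTwistGroup (by omega)

theorem inv_braidRun_mul_inv_braidRun {n a j k : ℕ} (hk : k < j) (hj : a + j < n) :
    (braidRun n a j)⁻¹ * (braidRun n (a + 1) k)⁻¹ = (braidRun n a k)⁻¹ * (braidRun n a j)⁻¹ := by
  rw [← mul_inv_rev, ← mul_inv_rev, braidRun_mul_braidRun hk (by omega)]

/-- Two strands that have arrived from the right at the positions `a` and `a + 1` may cross by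
arriving in the opposite order. -/
theorem inv_braidRun_mul_braidGen {n a j k : ℕ} (hk : k ≤ j) (hj : a + (j + 1) < n) :
    (braidRun n a (j + 1))⁻¹ * (braidRun n (a + 1) k)⁻¹ * braidGen n a =
      (braidRun n a k)⁻¹ * (braidRun n (a + 1) j)⁻¹ := by
  rw [inv_braidRun_mul_inv_braidRun (by omega) hj, braidRun_succ' n a j]
  group

/-- The crossing rule of `inv_braidRun_mul_braidGen` at the left end holds modulo `Γ_n^r` without
the restriction on the lengths. -/
theorem twistEquiv_inv_braidRun_mul_braidGen {n r j k : ℕ} (hj : j < r) (hk : k < r)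
    (hn : 2 * r ≤ n) :
    TwistEquiv r ((braidRun n 0 (j + 1))⁻¹ * (braidRun n 1 k)⁻¹ * braidGen n 0)
      ((braidRun n 0 k)⁻¹ * (braidRun n 1 j)⁻¹) := by
  rcases Nat.lt_or_ge j k with h | h
  swap
  · exact .of_eq (inv_braidRun_mul_braidGen h (by omega))
  have add_r : ∀ l, 0 + (l + r) < n →
      TwistEquiv r (braidRun n 0 l)⁻¹ (braidRun n 0 (l + r))⁻¹ := fun l hl =>
    twistEquiv_inv_braidRun (by simp [Nat.ModEq]) (by omega) hl
  calc TwistEquiv r ((braidRun n 0 (j + 1))⁻¹ * (braidRun n 1 k)⁻¹ * braidGen n 0)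
        ((braidRun n 0 (j + 1 + r))⁻¹ * (braidRun n 1 k)⁻¹ * braidGen n 0) :=
          ((add_r _ (by omega)).mul_right _).mul_right _
    TwistEquiv r _ ((braidRun n 0 k)⁻¹ * (braidRun n 1 (j + r))⁻¹) := by
          rw [add_right_comm]
          exact .of_eq (inv_braidRun_mul_braidGen (by omega) (by omega))
    TwistEquiv r _ ((braidRun n 0 (k + r))⁻¹ * (braidRun n 1 (j + r))⁻¹) :=
          (add_r _ (by omega)).mul_right _
    TwistEquiv r _ ((braidRun n 0 (j + r))⁻¹ * (braidRun n 0 (k + r))⁻¹) :=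
          .of_eq (inv_braidRun_mul_inv_braidRun (by omega) (by omega))
    TwistEquiv r _ ((braidRun n 0 j)⁻¹ * (braidRun n 0 (k + r))⁻¹) :=
          (add_r _ (by omega)).symm.mul_right _
    TwistEquiv r _ ((braidRun n 0 (k + r))⁻¹ * (braidRun n 1 j)⁻¹) :=
          .of_eq (inv_braidRun_mul_inv_braidRun (by omega) (by omega)).symm
    TwistEquiv r _ ((braidRun n 0 k)⁻¹ * (braidRun n 1 j)⁻¹) :=
          (add_r _ (by omega)).symm.mul_right _

theorem exists_modEq_of_lt (r : ℕ) (hr : 0 < r) (l R : ℕ) :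
    ∃ l', l ≡ l' [MOD r] ∧ R < l' ∧ l' ≤ R + r := by
  obtain ⟨s, rfl⟩ : ∃ s, r = s + 1 := ⟨r - 1, by omega⟩
  refine ⟨R + 1 + (l + s * (R + 1)) % (s + 1), ?_, by omega, ?_⟩
  · have h : R + 1 + (l + s * (R + 1)) % (s + 1) ≡ R + 1 + (l + s * (R + 1)) [MOD s + 1] :=
      (Nat.mod_modEq _ _).add_left _
    refine Nat.ModEq.symm (h.trans ?_)
    rw [show R + 1 + (l + s * (R + 1)) = l + (s + 1) * (R + 1) by ring]
    simp [Nat.ModEq]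
  · have := Nat.mod_lt (l + s * (R + 1)) hr
    omega

/-- A relation between cosets on the strands left of a supply of `r` further strands may be shifted
by one strand, behind any label at the first position: that label can be fetched from beyond all
the strands involved. -/
theorem TwistEquiv.shift {n r R l : ℕ} (hr : 0 < r) (hR : R + r < n) (hl : l < n)
    {x y : BraidGroup n} (hx : x ∈ braidInterval n 0 R) (hy : y ∈ braidInterval n 0 R)
    (h : TwistEquiv r x y) :
    TwistEquiv r ((braidRun n 0 l)⁻¹ * braidShift n x) ((braidRun n 0 l)⁻¹ * braidShift n y) := by
  obtain ⟨l', hl', h1, h2⟩ := exists_modEq_of_lt r hr l R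
  have e : ∀ z ∈ braidInterval n 0 R,
      (braidRun n 0 l')⁻¹ * braidShift n z = z * (braidRun n 0 l')⁻¹ := by
    intro z hz
    rw [inv_mul_eq_iff_eq_mul, ← mul_assoc, braidRun_mul_of_mem h1 (by omega) hz,
      mul_inv_cancel_right]
  have e0 : TwistEquiv r (braidRun n 0 l)⁻¹ (braidRun n 0 l')⁻¹ :=
    twistEquiv_inv_braidRun hl' (by omega) (by omega)
  refine (e0.mul_right _).trans (.trans ?_ (e0.symm.mul_right _))
  rw [e x hx, e y hy]
  exact h.mul_right _

/-! ### Normal forms on the leftmost strands -/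

/-- The braid that puts the labels `-l_0, -l_1, …` at the positions `0, 1, …`, each fetched from
the right. -/
def fetchBraid (n : ℕ) : List ℕ → BraidGroup n
  | [] => 1
  | l :: L => (braidRun n 0 l)⁻¹ * braidShift n (fetchBraid n L)

theorem fetchBraid_cons (n l : ℕ) (L : List ℕ) :
    fetchBraid n (l :: L) = (braidRun n 0 l)⁻¹ * braidShift n (fetchBraid n L) := rfl

theorem fetchBraid_mem {n r : ℕ} (hr : 0 < r) {L : List ℕ} (hL : ∀ l ∈ L, l < r)
    (hn : L.length + r ≤ n) : fetchBraid n L ∈ braidInterval n 0 (L.length + r - 1) := by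
  induction L with
  | nil => exact one_mem _
  | cons l L ih =>
    rw [List.length_cons] at hn ⊢
    have hl := hL l List.mem_cons_self
    refine mul_mem (inv_mem (braidRun_mem_braidInterval le_rfl (by omega))) ?_
    refine braidInterval_mono (Nat.zero_le 1) ?_ (braidShift_mem ?_
      (ih (fun l h => hL l (List.mem_cons_of_mem _ h)) (by omega))) <;> omega

theorem fetchBraid_eq_one_of_mem_braidPhiKer {n r : ℕ} (hr : 0 < r) {L : List ℕ}
    (hL : ∀ l ∈ L, l < r) (hn : L.length + 2 * r ≤ n + 1) (h : fetchBraid n L ∈ braidPhiKer n r) :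
    fetchBraid n L = 1 := by
  induction L with
  | nil => rfl
  | cons l L ih =>
    rw [List.length_cons] at hn
    have hL' : ∀ l ∈ L, l < r := fun l h => hL l (List.mem_cons_of_mem _ h)
    have hmem := fetchBraid_mem (n := n) hr hL' (by omega)
    -- the remaining letters do not touch the first coordinate, which therefore is `-l`
    obtain rfl : l = 0 := by
      rw [mem_braidPhiKer, fetchBraid_cons, braidAct_mul] at h
      set y := braidAct (r := r) (braidRun n 0 l)⁻¹ 0 with hy
      have h0 : y ⟨0, by omega⟩ = 0 := by
        rw [← braidAct_of_mem_braidInterval (braidShift_mem (by omega) hmem)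
          (Or.inl Nat.one_pos) y, h]
        rfl
      have hl := hL l List.mem_cons_self
      have h1 := braidAct_braidRun_apply (a := 0) (l := l) (by omega) y
      rw [hy, braidAct_braidAct_inv, ← hy, h0] at h1
      have h2 : (l : ZMod r) = 0 := (h1.trans (zero_add _)).symm
      exact Nat.eq_zero_of_dvd_of_lt ((ZMod.natCast_eq_zero_iff _ _).1 h2) hl
    rw [fetchBraid_cons, braidRun_zero, inv_one, one_mul] at h ⊢
    obtain ⟨l', hl', h1, h2⟩ := exists_modEq_of_lt r hr 0 (L.length + r - 1)
    have hrun : braidRun n 0 l' ∈ braidPhiKer n r := by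
      obtain ⟨t, rfl⟩ := (Nat.modEq_zero_iff_dvd).1 hl'.symm
      exact basicTwistGroup_le_braidPhiKer n r (braidRun_mul_mem_basicTwistGroup (by omega))
    rw [ih hL' (by omega), map_one]
    rw [← (braidPhiKer n r).mul_mem_cancel_left hrun, braidRun_mul_of_mem h1 (by omega) hmem]
    exact mul_mem h hrun

/-- A crossing of the first two strands exchanges the first two labels and raises one of them. -/
theorem twistEquiv_fetchBraid_mul_braidGen_zero {n r j j' k : ℕ} {L : List ℕ} (hr : 0 < r)
    (hj : j < r) (hj' : j' < r) (hjj : j ≡ j' + 1 [MOD r]) (hk : k < r) (hL : ∀ l ∈ L, l < r)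
    (hn : L.length + 1 + 2 * r ≤ n) :
    TwistEquiv r (fetchBraid n (j :: k :: L) * braidGen n 0) (fetchBraid n (k :: j' :: L)) := by
  have hmem := fetchBraid_mem (n := n) hr hL (by omega)
  have hc : Commute (braidGen n 0) (braidShift n (braidShift n (fetchBraid n L))) :=
    commute_of_mem_braidInterval Nat.one_lt_two
      (braidGen_mem_braidInterval le_rfl Nat.one_pos)
      (braidShift_mem (by omega) (braidShift_mem (by omega) hmem))
  have hs : ∀ l < r, braidShift n (braidRun n 0 l) = braidRun n 1 l := fun l hl =>
    braidShift_braidRun (by omega)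
  simp only [fetchBraid_cons, map_mul, map_inv, hs k hk, hs j' hj']
  have h1 : TwistEquiv r ((braidRun n 0 j)⁻¹ * (braidRun n 1 k)⁻¹ * braidGen n 0)
      ((braidRun n 0 k)⁻¹ * (braidRun n 1 j')⁻¹) :=
    (((twistEquiv_inv_braidRun hjj (by omega) (by omega)).mul_right _).mul_right _).trans
      (twistEquiv_inv_braidRun_mul_braidGen hj' hk (by omega))
  have h2 := h1.mul_right (braidShift n (braidShift n (fetchBraid n L)))
  rw [mul_assoc _ (braidGen n 0), hc.eq] at h2
  simpa only [mul_assoc] using h2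

/-- Crossings of the first `L.length` strands permute the cosets of the braids `fetchBraid n L`. -/
theorem exists_fetchBraid_mul_braidGen {n r : ℕ} (hr : 0 < r) {L : List ℕ} (hL : ∀ l ∈ L, l < r)
    (hn : L.length + 2 * r ≤ n + 1) {i : ℕ} (hi : i + 1 < L.length) :
    (∃ L' : List ℕ, L'.length = L.length ∧ (∀ l ∈ L', l < r) ∧
      TwistEquiv r (fetchBraid n L * braidGen n i) (fetchBraid n L')) ∧
    ∃ L' : List ℕ, L'.length = L.length ∧ (∀ l ∈ L', l < r) ∧
      TwistEquiv r (fetchBraid n L' * braidGen n i) (fetchBraid n L) := by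
  induction L generalizing i with
  | nil => simp at hi
  | cons a L ih =>
    rw [List.length_cons] at hn hi
    have ha := hL a List.mem_cons_self
    have hL' : ∀ l ∈ L, l < r := fun l h => hL l (List.mem_cons_of_mem _ h)
    cases i with
    | zero =>
      cases L with
      | nil => simp at hi
      | cons b L =>
        have hb := hL' b List.mem_cons_self
        have hL'' : ∀ l ∈ L, l < r := fun l h => hL' l (List.mem_cons_of_mem _ h)
        rw [List.length_cons] at hn
        have hmod : ∀ x, x % r < r := fun x => Nat.mod_lt x hr
        refine ⟨⟨b :: ((a + (r - 1)) % r) :: L, rfl, ?_, ?_⟩,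
          ⟨((b + 1) % r) :: a :: L, rfl, ?_, ?_⟩⟩
        · simp only [List.mem_cons]
          rintro l (rfl | rfl | h)
          exacts [hb, hmod _, hL'' l h]
        · refine twistEquiv_fetchBraid_mul_braidGen_zero hr ha (hmod _) ?_ hb hL'' (by omega)
          have h := (Nat.mod_modEq (a + (r - 1)) r).add_right 1
          refine Nat.ModEq.symm (h.trans ?_)
          rw [show a + (r - 1) + 1 = a + r by omega]
          simp [Nat.ModEq]
        · simp only [List.mem_cons]
          rintro l (rfl | rfl | h)
          exacts [hmod _, ha, hL'' l h]
        · exact twistEquiv_fetchBraid_mul_braidGen_zero hr (hmod _) hb (Nat.mod_modEq _ _) ha hL''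
            (by omega)
    | succ i =>
      have hmem : ∀ L' : List ℕ, L'.length = L.length → (∀ l ∈ L', l < r) →
          fetchBraid n L' ∈ braidInterval n 0 (L.length + r - 1) := fun L' h1 h2 => by
        have := fetchBraid_mem (n := n) hr h2 (by omega)
        rwa [h1] at this
      have hgen : braidGen n i ∈ braidInterval n 0 (L.length + r - 1) :=
        braidGen_mem_braidInterval (Nat.zero_le i) (by omega)
      have hcons : ∀ L' : List ℕ, fetchBraid n (a :: L') * braidGen n (i + 1) =
          (braidRun n 0 a)⁻¹ * braidShift n (fetchBraid n L' * braidGen n i) := fun L' => by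
        rw [map_mul, braidShift_braidGen (by omega), fetchBraid_cons, mul_assoc]
      have hlt : ∀ L' : List ℕ, (∀ l ∈ L', l < r) → ∀ l ∈ a :: L', l < r := fun L' h => by
        simp only [List.mem_cons]
        rintro l (rfl | h')
        exacts [ha, h l h']
      obtain ⟨⟨L1, h1, h1', e1⟩, ⟨L2, h2, h2', e2⟩⟩ := ih hL' (by omega) (i := i) (by omega)
      refine ⟨⟨a :: L1, by simp [h1], hlt L1 h1', ?_⟩, ⟨a :: L2, by simp [h2], hlt L2 h2', ?_⟩⟩
      · rw [hcons]
        exact e1.shift hr (by omega) (by omega) (mul_mem (hmem L rfl hL') hgen) (hmem L1 h1 h1')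
      · rw [hcons]
        exact e2.shift hr (by omega) (by omega) (mul_mem (hmem L2 h2 h2') hgen) (hmem L rfl hL')

theorem exists_twistEquiv_fetchBraid {n r m : ℕ} (hr : 0 < r) (hn : m + 2 * r ≤ n + 1)
    {β : BraidGroup n} (hβ : β ∈ braidInterval n 0 (m - 1)) :
    ∃ L : List ℕ, L.length = m ∧ (∀ l ∈ L, l < r) ∧ TwistEquiv r β (fetchBraid n L) := by
  induction hβ using Subgroup.closure_induction_right with
  | one =>
    refine ⟨List.replicate m 0, by simp, fun l hl => ?_, .of_eq ?_⟩
    · rwa [List.eq_of_mem_replicate hl]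
    · clear hn
      induction m with
      | zero => rfl
      | succ m ih => rw [List.replicate_succ, fetchBraid_cons, ← ih]; simp
  | mul_right x hx y hy ih =>
    obtain ⟨i, ⟨_, hi⟩, rfl⟩ := hy
    obtain ⟨L, rfl, hL, e⟩ := ih
    obtain ⟨L', h1, h2, h3⟩ := (exists_fetchBraid_mul_braidGen hr hL hn (i := i) (by omega)).1
    exact ⟨L', h1, h2, (e.mul_right _).trans h3⟩
  | mul_inv_cancel x hx y hy ih =>
    obtain ⟨i, ⟨_, hi⟩, rfl⟩ := hy
    obtain ⟨L, rfl, hL, e⟩ := ih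
    obtain ⟨L', h1, h2, h3⟩ := (exists_fetchBraid_mul_braidGen hr hL hn (i := i) (by omega)).2
    refine ⟨L', h1, h2, (e.mul_right _).trans ?_⟩
    have := (h3.mul_right (braidGen n i)⁻¹).symm
    rwa [mul_inv_cancel_right] at this

/-- The kernel of `φ_r` on the leftmost `m ≤ n - 2r + 1` strands is contained in `Γ_n^r`. -/
theorem mem_basicTwistGroup_of_mem_left {n r m : ℕ} (hr : 0 < r) (hn : m + 2 * r ≤ n + 1)
    {β : BraidGroup n} (hβ : β ∈ braidInterval n 0 (m - 1)) (hker : β ∈ braidPhiKer n r) :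
    β ∈ basicTwistGroup n r := by
  obtain ⟨L, rfl, hL, e⟩ := exists_twistEquiv_fetchBraid hr hn hβ
  rw [fetchBraid_eq_one_of_mem_braidPhiKer hr hL hn (e.mem_braidPhiKer_iff.1 hker), TwistEquiv,
    inv_one, mul_one] at e
  exact e

/-! ### The mirror automorphism -/

/-- The involution `σ_i ↦ σ_{n-2-i}⁻¹` of `B_n`, which exchanges the two ends of the row of
strands. -/
def braidMirror (n : ℕ) : BraidGroup n →* BraidGroup n :=
  PresentedGroup.toGroup (f := fun i => (braidGen n (n - 2 - i.val))⁻¹)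
    (braidRels_lift_eq_one _
      (by
        intro i j hij
        have hj := j.isLt
        have h := braidGen_braid (n := n) (i := n - 2 - j.val) (by omega)
        rw [show n - 2 - i.val = n - 2 - j.val + 1 by omega]
        simpa only [mul_inv_rev, mul_assoc] using (congrArg (·⁻¹) h).symm)
      (by
        intro i j hij
        have hj := j.isLt
        exact ((commute_braidGen (n := n) (by omega)).inv_inv).eq))

theorem braidMirror_braidGen {n i : ℕ} (h : i < n - 1) :
    braidMirror n (braidGen n i) = (braidGen n (n - 2 - i))⁻¹ := by
  rw [braidGen_of_lt h]
  exact PresentedGroup.toGroup.of _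

theorem braidMirror_braidRun {n a l : ℕ} (h : a + l ≤ n - 1) :
    braidMirror n (braidRun n a l) = (braidRun n (n - 1 - a - l) l)⁻¹ := by
  induction l with
  | zero => simp
  | succ l ih =>
    rw [braidRun_succ, map_mul, ih (by omega), braidMirror_braidGen (by omega), braidRun_succ',
      mul_inv_rev, show n - 2 - (a + l) = n - 1 - a - (l + 1) by omega,
      show n - 1 - a - (l + 1) + 1 = n - 1 - a - l by omega]

@[simp]
theorem braidMirror_braidMirror {n : ℕ} (β : BraidGroup n) :
    braidMirror n (braidMirror n β) = β := by
  have hle : braidInterval n 0 (n - 1) ≤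
      ((braidMirror n).comp (braidMirror n)).eqLocus (MonoidHom.id _) := by
    rw [braidInterval_le_iff]
    intro i _ hi
    change braidMirror n (braidMirror n (braidGen n i)) = braidGen n i
    rw [braidMirror_braidGen hi, map_inv, braidMirror_braidGen (by omega), inv_inv,
      show n - 2 - (n - 2 - i) = i by omega]
  exact hle (mem_braidInterval_full β)

theorem braidMirror_mem_braidInterval {n a b : ℕ} (hb : b ≤ n - 1) {β : BraidGroup n}
    (hβ : β ∈ braidInterval n a b) : braidMirror n β ∈ braidInterval n (n - 1 - b) (n - 1 - a) := by
  have hle : braidInterval n a b ≤ (braidInterval n (n - 1 - b) (n - 1 - a)).comap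
      (braidMirror n) := by
    rw [braidInterval_le_iff]
    intro i h1 h2
    rw [Subgroup.mem_comap, braidMirror_braidGen (by omega)]
    exact inv_mem (braidGen_mem_braidInterval (by omega) (by omega))
  exact hle hβ

theorem braidMirror_mem_basicTwistGroup {n r : ℕ} {β : BraidGroup n}
    (hβ : β ∈ basicTwistGroup n r) : braidMirror n β ∈ basicTwistGroup n r := by
  have hle : basicTwistGroup n r ≤ (basicTwistGroup n r).comap (braidMirror n) := by
    refine (Subgroup.closure_le _).2 ?_
    rintro _ ⟨a, h, rfl⟩
    rw [SetLike.mem_coe, Subgroup.mem_comap, basicTwist_eq_braidRun, braidMirror_braidRun (by omega)]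
    exact inv_mem (braidRun_mem_basicTwistGroup (by omega))
  exact hle hβ

theorem TwistEquiv.braidMirror {n r : ℕ} {x y : BraidGroup n} (h : TwistEquiv r x y) :
    TwistEquiv r (braidMirror n x) (braidMirror n y) := by
  have := braidMirror_mem_basicTwistGroup h
  rwa [map_mul, map_inv] at this

/-- On states, the mirror automorphism reverses the order of the labels and changes their signs. -/
theorem braidAct_braidMirror {n r : ℕ} (β : BraidGroup n) (x : Fin n → ZMod r) :
    braidAct (braidMirror n β) (fun q => -x q.rev) = fun q => -braidAct β x q.rev := by
  let K : Subgroup (BraidGroup n) :=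
    { carrier := {γ | ∀ x : Fin n → ZMod r,
        braidAct (braidMirror n γ) (fun q => -x q.rev) = fun q => -braidAct γ x q.rev}
      one_mem' := fun x => by simp
      mul_mem' := fun {α γ} hα hγ x => by rw [map_mul, braidAct_mul, braidAct_mul, hα, hγ]
      inv_mem' := fun {α} hα x => by
        have h := hα (braidAct α⁻¹ x)
        rw [braidAct_braidAct_inv] at h
        rw [map_inv, ← h, braidAct_inv_braidAct] }
  have hle : braidInterval n 0 (n - 1) ≤ K := by
    rw [braidInterval_le_iff]
    intro i _ hi x
    obtain ⟨c, rfl⟩ : ∃ c, n = c + i + 2 := ⟨n - 2 - i, by omega⟩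
    have hc : c < c + i + 2 := by omega
    have hc' : c + 1 < c + i + 2 := by omega
    have e1 : Fin.rev (⟨c + 1, hc'⟩ : Fin (c + i + 2)) = ⟨i, by omega⟩ := by
      ext; simp only [Fin.val_rev]; omega
    have e2 : Fin.rev (⟨c, hc⟩ : Fin (c + i + 2)) = ⟨i + 1, by omega⟩ := by
      ext; simp only [Fin.val_rev]; omega
    have key : braidAct (braidGen _ c) (fun q => -braidAct (braidGen (c + i + 2) i) x q.rev) =
        fun q => -x q.rev := by
      ext q
      by_cases h1 : q.val = c
      · obtain rfl : q = ⟨c, hc⟩ := Fin.ext h1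
        rw [braidAct_braidGen_left (by omega)]
        rw [e1, e2, braidAct_braidGen_left]
      by_cases h2 : q.val = c + 1
      · obtain rfl : q = ⟨c + 1, hc'⟩ := Fin.ext h2
        rw [braidAct_braidGen_right (by omega)]
        rw [e1, e2, braidAct_braidGen_right]
        ring
      · rw [braidAct_braidGen_of_ne h1 h2, braidAct_braidGen_of_ne]
        · rw [Fin.val_rev]; omega
        · rw [Fin.val_rev]; omega
    rw [braidMirror_braidGen hi, ← key, show c + i + 2 - 2 - i = c by omega,
      braidAct_inv_braidAct]
  exact hle (mem_braidInterval_full β) x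

theorem braidMirror_mem_braidPhiKer {n r : ℕ} {β : BraidGroup n} (hβ : β ∈ braidPhiKer n r) :
    braidMirror n β ∈ braidPhiKer n r := by
  rw [mem_braidPhiKer] at hβ ⊢
  have h := braidAct_braidMirror (r := r) β 0
  rw [hβ] at h
  simpa [← Pi.zero_def] using h

/-- The kernel of `φ_r` on the rightmost `n - m` strands is contained in `Γ_n^r`. -/
theorem mem_basicTwistGroup_of_mem_right {n r m : ℕ} (hr : 0 < r) (hm : 2 * r ≤ m + 1) (hn : m ≤ n)
    {β : BraidGroup n} (hβ : β ∈ braidInterval n m (n - 1)) (hker : β ∈ braidPhiKer n r) :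
    β ∈ basicTwistGroup n r := by
  rw [← braidMirror_braidMirror β]
  refine braidMirror_mem_basicTwistGroup (mem_basicTwistGroup_of_mem_left (m := n - m) hr (by omega)
    ?_ (braidMirror_mem_braidPhiKer hker))
  exact braidInterval_mono (by omega) (by omega) (braidMirror_mem_braidInterval le_rfl hβ)

/-! ### Splitting a braid into a left and a right part -/

theorem TwistEquiv.mul_of_commute {n r : ℕ} {x x' y y' : BraidGroup n} (hx : TwistEquiv r x x')
    (hy : TwistEquiv r y y') (h : Commute x' y) (h' : Commute x' y') :
    TwistEquiv r (x * y) (x' * y') := by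
  refine (hx.mul_right y).trans ?_
  rw [h.eq, h'.eq]
  exact hy.mul_right x'

/-- A coset of the braids on the leftmost `m` strands is reached by bringing the label of the last
of these strands from the left, followed by a braid on the other `m - 1` strands. -/
theorem exists_twistEquiv_left {n r m : ℕ} (hr : 0 < r) (hm : 4 ≤ m) (hn : m + 2 * r ≤ n + 1)
    {β : BraidGroup n} (hβ : β ∈ braidInterval n 0 (m - 1)) :
    ∃ c : ℕ, ∀ j, c ≡ j [MOD r] → j < m → ∃ γ ∈ braidInterval n 0 (m - 2),
      TwistEquiv r β (braidRun n (m - 1 - j) j * γ) := by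
  have : NeZero r := ⟨hr.ne'⟩
  refine ⟨(braidAct (r := r) β 0 ⟨m - 1, by omega⟩).val, fun j hj hjm => ?_⟩
  obtain ⟨γ, hγ, e⟩ := sameOrbit_of_eq (p := m - 1) (by omega) (by omega)
    (x := braidAct (r := r) (braidRun n (m - 1 - j) j) 0) (y := braidAct β 0) (by
      intro q hq
      rw [braidAct_braidRun_zero (by omega), Pi.single_apply]
      split_ifs with h
      · rw [← (ZMod.natCast_eq_natCast_iff _ _ _).2 hj, ZMod.natCast_zmod_val, h]
        congr 2
        omega
      · rw [braidAct_of_mem_braidInterval hβ (Or.inr ?_)]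
        · rfl
        · rw [Fin.ext_iff] at h
          simp only at h
          omega)
  refine ⟨γ, hγ, mem_basicTwistGroup_of_mem_left hr hn
    (mul_mem hβ (inv_mem (mul_mem ?_ ?_))) (mul_inv_mem_braidPhiKer.2 ?_)⟩
  · exact braidRun_mem_braidInterval (Nat.zero_le _) (by omega)
  · exact braidInterval_mono le_rfl (by omega) hγ
  · rw [braidAct_mul, e]

theorem exists_twistEquiv_right {n r m : ℕ} (hr : 0 < r) (hm : 2 * r ≤ m + 1) (hn : m + 4 ≤ n)
    {β : BraidGroup n} (hβ : β ∈ braidInterval n m (n - 1)) :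
    ∃ c : ℕ, ∀ j, c ≡ j [MOD r] → m + j < n → ∃ γ ∈ braidInterval n (m + 1) (n - 1),
      TwistEquiv r β ((braidRun n m j)⁻¹ * γ) := by
  obtain ⟨c, hc⟩ := exists_twistEquiv_left (m := n - m) hr (by omega) (by omega)
    (braidInterval_mono (by omega) (by omega) (braidMirror_mem_braidInterval le_rfl hβ))
  refine ⟨c, fun j hj hjm => ?_⟩
  obtain ⟨γ, hγ, e⟩ := hc j hj (by omega)
  refine ⟨braidMirror n γ, braidInterval_mono ?_ ?_ (braidMirror_mem_braidInterval ?_ hγ), ?_⟩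
  · omega
  · omega
  · omega
  · have := e.braidMirror
    rwa [braidMirror_braidMirror, map_mul, braidMirror_braidRun (by omega),
      show n - 1 - (n - m - 1 - j) - j = m by omega] at this

/-- The crossing of the last strand of the left part and the first strand of the right part. -/
theorem twistEquiv_middle {n r m j k : ℕ} (hj : j < r) (hk : k < r) (hm : r < m)
    (hn : m + 2 * r ≤ n) :
    TwistEquiv r (braidRun n (m - 1 - j) j * (braidRun n m k)⁻¹ * braidGen n (m - 1))
      (braidRun n (m - 1 - (r - k)) (r - k) * (braidRun n m (2 * r - 1 - j))⁻¹) := by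
  -- a label brought from the left may as well be fetched from the right
  have h1 : TwistEquiv r (braidRun n (m - 1 - j) j) (braidRun n (m - 1) (2 * r - 1 - j + 1))⁻¹ := by
    have h := braidRun_add n (m - 1 - j) j (2 * r - 1 - j + 1)
    rw [show j + (2 * r - 1 - j + 1) = r * 2 by omega, show m - 1 - j + j = m - 1 by omega] at h
    rw [TwistEquiv, inv_inv, ← h]
    exact braidRun_mul_mem_basicTwistGroup (by omega)
  have h2 : TwistEquiv r (braidRun n (m - 1 - (r - k)) (r - k)) (braidRun n (m - 1) k)⁻¹ := by
    have h := braidRun_add n (m - 1 - (r - k)) (r - k) k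
    rw [show r - k + k = r by omega, show m - 1 - (r - k) + (r - k) = m - 1 by omega] at h
    rw [TwistEquiv, inv_inv, ← h]
    exact braidRun_mem_basicTwistGroup (by omega)
  have h3 := inv_braidRun_mul_braidGen (n := n) (a := m - 1) (j := 2 * r - 1 - j) (k := k)
    (by omega) (by omega)
  rw [show m - 1 + 1 = m by omega] at h3
  refine ((h1.mul_right _).mul_right _).trans ?_
  rw [h3]
  exact h2.symm.mul_right _

/-- Every coset of `Γ_n^r` contains a product of a braid on the first `2r` strands and one on the
other strands. -/
theorem exists_twistEquiv_mul {n r : ℕ} (hr : 2 ≤ r) (hn : 4 * r ≤ n) (β : BraidGroup n) :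
    ∃ b ∈ braidInterval n 0 (2 * r - 1), ∃ b' ∈ braidInterval n (2 * r) (n - 1),
      TwistEquiv r β (b * b') := by
  -- the labels of the two middle strands can be brought to their places before everything else
  have split : ∀ b ∈ braidInterval n 0 (2 * r - 1), ∀ b' ∈ braidInterval n (2 * r) (n - 1),
      ∃ c d : ℕ, ∀ j k, c ≡ j [MOD r] → d ≡ k [MOD r] → j < 2 * r → k < 2 * r →
        ∃ γ ∈ braidInterval n 0 (2 * r - 2), ∃ γ' ∈ braidInterval n (2 * r + 1) (n - 1),
          TwistEquiv r (b * b')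
            (braidRun n (2 * r - 1 - j) j * (braidRun n (2 * r) k)⁻¹ * (γ * γ')) := by
    intro b hb b' hb'
    obtain ⟨c, hc⟩ := exists_twistEquiv_left (r := r) (m := 2 * r) (by omega) (by omega) (by omega) hb
    obtain ⟨d, hd⟩ := exists_twistEquiv_right (r := r) (m := 2 * r) (by omega) (by omega)
      (by omega) hb'
    refine ⟨c, d, fun j k hj hk hj' hk' => ?_⟩
    obtain ⟨γ, hγ, e⟩ := hc j hj hj'
    obtain ⟨γ', hγ', e'⟩ := hd k hk (by omega)
    refine ⟨γ, hγ, γ', hγ', ?_⟩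
    have hrun : (braidRun n (2 * r) k)⁻¹ ∈ braidInterval n (2 * r) (n - 1) :=
      inv_mem (braidRun_mem_braidInterval le_rfl (by omega))
    have hu : braidRun n (2 * r - 1 - j) j * γ ∈ braidInterval n 0 (2 * r - 1) :=
      mul_mem (braidRun_mem_braidInterval (Nat.zero_le _) (by omega))
        (braidInterval_mono le_rfl (by omega) hγ)
    have hv : (braidRun n (2 * r) k)⁻¹ * γ' ∈ braidInterval n (2 * r) (n - 1) :=
      mul_mem hrun (braidInterval_mono (by omega) le_rfl hγ')
    have hc : Commute γ (braidRun n (2 * r) k)⁻¹ :=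
      commute_of_mem_braidInterval (by omega) hγ hrun
    refine (e.mul_of_commute e' (commute_of_mem_braidInterval (by omega) hu hb')
      (commute_of_mem_braidInterval (by omega) hu hv)).trans (.of_eq ?_)
    rw [mul_assoc, ← mul_assoc γ, hc.eq]
    simp only [mul_assoc]
  have unsplit : ∀ j k, j < 2 * r → k < 2 * r →
      ∀ γ ∈ braidInterval n 0 (2 * r - 2), ∀ γ' ∈ braidInterval n (2 * r + 1) (n - 1),
      ∃ b ∈ braidInterval n 0 (2 * r - 1), ∃ b' ∈ braidInterval n (2 * r) (n - 1),
        braidRun n (2 * r - 1 - j) j * (braidRun n (2 * r) k)⁻¹ * (γ * γ') = b * b' := by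
    intro j k hj hk γ hγ γ' hγ'
    have hrun : (braidRun n (2 * r) k)⁻¹ ∈ braidInterval n (2 * r) (n - 1) :=
      inv_mem (braidRun_mem_braidInterval le_rfl (by omega))
    have hc : Commute γ (braidRun n (2 * r) k)⁻¹ :=
      commute_of_mem_braidInterval (by omega) hγ hrun
    refine ⟨_, mul_mem (braidRun_mem_braidInterval (a' := 2 * r - 1 - j) (l := j) (Nat.zero_le _)
      (by omega)) (braidInterval_mono le_rfl (by omega) hγ), _,
      mul_mem hrun (braidInterval_mono (by omega) le_rfl hγ'), ?_⟩
    rw [mul_assoc _ γ, ← mul_assoc γ, hc.eq]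
    simp only [mul_assoc]
  -- the crossing of the two middle strands
  have middle : ∀ j k, j < r → k < r →
      ∀ γ ∈ braidInterval n 0 (2 * r - 2), ∀ γ' ∈ braidInterval n (2 * r + 1) (n - 1),
      TwistEquiv r (braidRun n (2 * r - 1 - j) j * (braidRun n (2 * r) k)⁻¹ * (γ * γ') *
          braidGen n (2 * r - 1))
        (braidRun n (2 * r - 1 - (r - k)) (r - k) *
          (braidRun n (2 * r) (2 * r - 1 - j))⁻¹ * (γ * γ')) := by
    intro j k hj hk γ hγ γ' hγ'
    have hs : braidGen n (2 * r - 1) ∈ braidInterval n (2 * r - 1) (2 * r) :=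
      braidGen_mem_braidInterval le_rfl (by omega)
    have hc : Commute (γ * γ') (braidGen n (2 * r - 1)) :=
      (commute_of_mem_braidInterval (by omega) hγ hs).mul_left
        (commute_of_mem_braidInterval (by omega) hs hγ').symm
    rw [mul_assoc _ (γ * γ'), hc.eq, ← mul_assoc]
    exact (twistEquiv_middle hj hk (by omega) (by omega)).mul_right _
  have hβ := mem_braidInterval_full β
  induction hβ using Subgroup.closure_induction_right with
  | one => exact ⟨1, one_mem _, 1, one_mem _, .of_eq (mul_one 1).symm⟩
  | mul_right x _ y hy ih =>
    obtain ⟨i, ⟨_, hi⟩, rfl⟩ := hy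
    obtain ⟨b, hb, b', hb', e⟩ := ih
    rcases lt_trichotomy i (2 * r - 1) with h | rfl | h
    · have hs : braidGen n i ∈ braidInterval n 0 (2 * r - 1) :=
        braidGen_mem_braidInterval (Nat.zero_le i) h
      refine ⟨b * braidGen n i, mul_mem hb hs, b', hb', (e.mul_right _).trans (.of_eq ?_)⟩
      rw [mul_assoc, mul_assoc, (commute_of_mem_braidInterval (by omega) hs hb').eq]
    · obtain ⟨c, d, H⟩ := split b hb b' hb'
      have hc := Nat.mod_lt c (show 0 < r by omega)
      have hd := Nat.mod_lt d (show 0 < r by omega)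
      obtain ⟨γ, hγ, γ', hγ', e'⟩ := H (c % r) (d % r) (Nat.mod_modEq _ _).symm
        (Nat.mod_modEq _ _).symm (by omega) (by omega)
      obtain ⟨b1, h1, b1', h1', e1⟩ := unsplit (r - d % r) (2 * r - 1 - c % r) (by omega) (by omega)
        γ hγ γ' hγ'
      refine ⟨b1, h1, b1', h1', ?_⟩
      rw [← e1]
      exact ((e.trans e').mul_right _).trans (middle _ _ hc hd γ hγ γ' hγ')
    · refine ⟨b, hb, b' * braidGen n i,
        mul_mem hb' (braidGen_mem_braidInterval (by omega) hi), ?_⟩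
      rw [← mul_assoc]
      exact e.mul_right _
  | mul_inv_cancel x _ y hy ih =>
    obtain ⟨i, ⟨_, hi⟩, rfl⟩ := hy
    obtain ⟨b, hb, b', hb', e⟩ := ih
    rcases lt_trichotomy i (2 * r - 1) with h | rfl | h
    · have hs : (braidGen n i)⁻¹ ∈ braidInterval n 0 (2 * r - 1) :=
        inv_mem (braidGen_mem_braidInterval (Nat.zero_le i) h)
      refine ⟨b * (braidGen n i)⁻¹, mul_mem hb hs, b', hb', (e.mul_right _).trans (.of_eq ?_)⟩
      rw [mul_assoc, mul_assoc, (commute_of_mem_braidInterval (by omega) hs hb').eq]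
    · -- the residues are represented by `r - k` and `2r - 1 - j` as on the right of `middle`
      obtain ⟨c, d, H⟩ := split b hb b' hb'
      obtain ⟨p, hp, hp1, hp2⟩ := exists_modEq_of_lt r (by omega) c 0
      obtain ⟨q, hq, hq1, hq2⟩ := exists_modEq_of_lt r (by omega) d (r - 1)
      obtain ⟨γ, hγ, γ', hγ', e'⟩ := H p q hp hq (by omega) (by omega)
      obtain ⟨b1, h1, b1', h1', e1⟩ := unsplit (2 * r - 1 - q) (r - p) (by omega) (by omega)
        γ hγ γ' hγ'
      refine ⟨b1, h1, b1', h1', ?_⟩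
      have hm := middle (2 * r - 1 - q) (r - p) (by omega) (by omega) γ hγ γ' hγ'
      rw [e1, show r - (r - p) = p by omega, show 2 * r - 1 - (2 * r - 1 - q) = q by omega] at hm
      have := ((e.trans e').trans hm.symm).mul_right (braidGen n (2 * r - 1))⁻¹
      rwa [mul_inv_cancel_right] at this
    · refine ⟨b, hb, b' * (braidGen n i)⁻¹,
        mul_mem hb' (inv_mem (braidGen_mem_braidInterval (by omega) hi)), ?_⟩
      rw [← mul_assoc]
      exact e.mul_right _

/-! ### The kernel -/

theorem braidPhiKer_eq_basicTwistGroup {n r : ℕ} (hr : 2 ≤ r) (hn : 4 * r ≤ n) :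
    braidPhiKer n r = basicTwistGroup n r := by
  refine le_antisymm (fun β hβ => ?_) (basicTwistGroup_le_braidPhiKer n r)
  obtain ⟨b, hb, b', hb', e⟩ := exists_twistEquiv_mul hr hn β
  have hbb := e.mem_braidPhiKer_iff.1 hβ
  -- the two factors act on disjoint sets of coordinates
  have h1 : b ∈ braidPhiKer n r := by
    rw [mem_braidPhiKer] at hbb ⊢
    ext q
    rcases Nat.lt_or_ge q.val (2 * r) with hq | hq
    · rw [← braidAct_of_mem_braidInterval hb' (Or.inl hq) (braidAct b 0),
        ← braidAct_mul, hbb]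
    · exact braidAct_of_mem_braidInterval hb (Or.inr (by omega)) 0
  have h2 : b' ∈ braidPhiKer n r := ((braidPhiKer n r).mul_mem_cancel_left h1).1 hbb
  have h3 := mul_mem
    (mem_basicTwistGroup_of_mem_left (m := 2 * r) (by omega) (by omega) hb h1)
    (mem_basicTwistGroup_of_mem_right (m := 2 * r) (by omega) (by omega) (by omega) hb' h2)
  have h4 := mul_mem e h3
  rwa [inv_mul_cancel_right] at h4

/-- Conjugation by `δ = σ_0 ⋯ σ_{n-2}` carries each basic twist to the next one, and `δ` is itself
a product of basic twists when `r ∣ n - 1`. -/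
theorem basicTwistGroup_eq_closure_pair {n r : ℕ} (h : 0 + r < n) (h' : 0 + (n - 1) < n)
    (hdvd : r ∣ n - 1) :
    basicTwistGroup n r = Subgroup.closure {basicTwist 0 r h, basicTwist 0 (n - 1) h'} := by
  rw [basicTwist_eq_braidRun, basicTwist_eq_braidRun]
  apply le_antisymm
  · refine (Subgroup.closure_le _).2 ?_
    rintro _ ⟨a, ha, rfl⟩
    rw [SetLike.mem_coe, basicTwist_eq_braidRun]
    induction a with
    | zero => exact Subgroup.subset_closure (Set.mem_insert _ _)
    | succ a ih =>
      have hδ : braidDelta n ∈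
          Subgroup.closure {braidRun n 0 r, braidRun n 0 (n - 1)} :=
        Subgroup.subset_closure (Set.mem_insert_of_mem _ rfl)
      rw [← braidShift_braidRun (by omega), braidShift_apply]
      exact mul_mem (mul_mem hδ (ih (by omega))) (inv_mem hδ)
  · rw [Subgroup.closure_le, Set.insert_subset_iff, Set.singleton_subset_iff]
    obtain ⟨t, ht⟩ := hdvd
    refine ⟨braidRun_mem_basicTwistGroup h, ?_⟩
    have := braidRun_mul_mem_basicTwistGroup (n := n) (r := r) (a := 0) (t := t) (by omega)
    rwa [← ht] at this

theorem four_mul_le_of_boundN0_le {n r d : ℕ} (hn : boundN0 r d ≤ n) : 4 * r ≤ n := by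
  unfold boundN0 at hn
  split_ifs at hn
  · omega
  · nlinarith
  · nlinarith

theorem mainTheorem3 (n r : ℕ) (hr : 2 ≤ r) (hn : boundN0 r (n % 3) ≤ n) :
    braidPhiKer n r = basicTwistGroup n r ∧
      (r ∣ n - 1 →
        braidPhiKer n r = Subgroup.closure
          {basicTwist 0 r (zero_add_lt_of_boundN0_le hr hn),
            basicTwist 0 (n - 1) (zero_add_sub_one_lt_of_boundN0_le hr hn)}) := by
  have hker := braidPhiKer_eq_basicTwistGroup hr (four_mul_le_of_boundN0_le hn)
  exact ⟨hker, fun hdvd => hker.trans (basicTwistGroup_eq_closure_pair _ _ hdvd)⟩
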